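/- An operator system is a linear subspace $S$ of a unital C*-algebra $D$ with $1\in S$ and $S^*=S$. A linear map $\varphi:S\to B$ into a unital C*-algebra is unital completely positive (u.c.p.) if $\varphi(1)=1$ and, for every $k$, applying $\varphi$ entrywise sends each matrix in $M_k(S)$ that is positive in $M_k(D)$ to a positive element of $M_k(B)$. A unital C*-algebra $B$ is injective if for all operator systems $S\subseteq T$ every u.c.p. map $S\to B$ extends to a u.c.p. map $T\to B$. An injective envelope of a unital C*-algebra $A$ is an injective C*-algebra $I(A)$ together with a one-to-one unital $*$-homomorphism $\kappa:A\to I(A)$ such that the identity is the only u.c.p. map $I(A)\to I(A)$ that fixes every element of $\kappa(A)$. **Theorem.** Let $\mathcal A$ be a commutative unital C*-algebra. Then $\mathcal A$ has an injective envelope. Moreover, if $\kappa:\mathcal A\to I(\mathcal A)$ is any injective envelope of $\mathcal A$, $\mathcal B$ is an injective C*-algebra and $\pi:\mathcal A\to\mathcal B$ is a one-to-one $*$-homomorphism (not assumed to be unital), then there is a one-to-one $*$-homomorphism $\rho:I(\mathcal A)\to\mathcal B$ with $\rho\circ\kappa=\pi$. -/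

import Mathlib

open scoped Matrix

universe u v

namespace OpSys

/-- A square matrix over a C*-algebra `A` is positive, as an element of the C*-algebra `M_k(A)`, if
it has the form `Nᴴ * N`; here `(Nᴴ) i j = star (N j i)`. -/
def IsPositiveMatrix {A : Type u} [CStarAlgebra A] {k : ℕ} (M : Matrix (Fin k) (Fin k) A) : Prop :=
  ∃ N : Matrix (Fin k) (Fin k) A, M = Nᴴ * N

/-- An operator system: a linear subspace of a unital C*-algebra that contains the unit and is
closed under the involution. -/
structure IsOperatorSystem {D : Type u} [CStarAlgebra D] (S : Submodule ℂ D) : Prop where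
  one_mem : (1 : D) ∈ S
  star_mem : ∀ x ∈ S, star x ∈ S

/-- A unital C*-algebra is an operator system. -/
theorem isOperatorSystem_top {D : Type u} [CStarAlgebra D] :
    IsOperatorSystem (⊤ : Submodule ℂ D) :=
  ⟨Submodule.mem_top, fun _ _ => Submodule.mem_top⟩

/-- A linear map from an operator system `S ⊆ D` to a unital C*-algebra `B` is unital and completely
positive: for each `k`, applying it entrywise sends every matrix over `S` that is positive in
`M_k(D)` to a positive element of `M_k(B)`. -/
structure IsUCP {D : Type u} [CStarAlgebra D] {B : Type v} [CStarAlgebra B]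
    {S : Submodule ℂ D} (hS : IsOperatorSystem S) (φ : S →ₗ[ℂ] B) : Prop where
  map_one : φ ⟨1, hS.one_mem⟩ = 1
  map_pos : ∀ (k : ℕ) (M : Matrix (Fin k) (Fin k) S),
    IsPositiveMatrix (M.map (fun s : S => (s : D))) → IsPositiveMatrix (M.map φ)

/-- A unital C*-algebra `B` is injective if it is an injective object in the category of operator
systems and unital completely positive maps: for all operator systems `S ⊆ T`, each unital
completely positive map `S → B` extends to a unital completely positive map `T → B`. -/
def IsInjective (B : Type u) [CStarAlgebra B] : Prop :=
  ∀ (D : Type u) [CStarAlgebra D] (S T : Submodule ℂ D)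
    (hS : IsOperatorSystem S) (hT : IsOperatorSystem T) (hST : S ≤ T) (φ : S →ₗ[ℂ] B),
    IsUCP hS φ →
      ∃ ψ : T →ₗ[ℂ] B, IsUCP hT ψ ∧ ∀ s : S, ψ (Submodule.inclusion hST s) = φ s

/-- A unital *-homomorphism `κ : A → E` makes `E` an injective envelope of `A` (in the sense of
Hamana): `κ` is one-to-one, `E` is injective, and the extension is rigid, i.e. the identity is the
only unital completely positive map `E → E` that fixes every element of `κ(A)`. -/
structure IsInjectiveEnvelope {A : Type u} [CStarAlgebra A] {E : Type u} [CStarAlgebra E]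
    (κ : A →⋆ₐ[ℂ] E) : Prop where
  injective : Function.Injective κ
  isInjective : IsInjective E
  rigid : ∀ φ : E →ₗ[ℂ] E, IsUCP isOperatorSystem_top (φ.domRestrict ⊤) →
    (∀ a : A, φ (κ a) = κ a) → φ = LinearMap.id

end OpSys

/-! By Gelfand duality `A` is `C(X)`, with `X` its character space. Let `p : G → X` be the Gleason
cover: `G` is projective among compact Hausdorff spaces and `p` is an irreducible surjection. Then
`f ↦ f ∘ p` is an injective envelope. `C(G)` is injective because positive functionals extend point
by point, and projectivity of `G` lets the extensions be regularised into continuous functions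
(`isInjective_of_projective`). It is rigid because, by irreducibility, every nonempty open set of
`G` contains the full preimage of a nonempty open set of `X` (`IsIrreducibleMap.eq_id_of_fixed`).
Two envelopes are related by mutually inverse u.c.p. maps, which are multiplicative by
Kadison–Schwarz, so any envelope may be replaced by `C(G)`.

For the embedding, a u.c.p. extension of `π` need not be multiplicative, so the argument is
topological. An injective `B` is monotone complete, and the bicommutant of `π(A)` is commutative and
closed under suprema. Hence it is `C(Y)` with `Y` extremally disconnected. Dually, `π` is a
surjection onto `X` from the clopen support of `π(1)` in `Y`. This support is projective, so the
surjection lifts to `G`; irreducibility makes the lift onto, and pulling back along it embeds `C(G)`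
in `C(Y) ⊆ B`. -/

namespace OpSys

open Set Topology Filter
open scoped ComplexStarModule ComplexOrder BoundedContinuousFunction

/-! ### Irreducible maps and Gleason covers -/

/-- A map is irreducible if no proper closed subset of its source is mapped onto the target. -/
def IsIrreducibleMap {G X : Type*} [TopologicalSpace G] (p : G → X) : Prop :=
  ∀ C : Set G, C ≠ univ → IsClosed C → p '' C ≠ univ

theorem IsIrreducibleMap.exists_preimage_subset {G X : Type*} [TopologicalSpace G] [CompactSpace G]
    [TopologicalSpace X] [T2Space X] {p : G → X} (hp : IsIrreducibleMap p) (hc : Continuous p)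
    {U : Set G} (hU : IsOpen U) (hne : U.Nonempty) :
    ∃ V : Set X, IsOpen V ∧ V.Nonempty ∧ p ⁻¹' V ⊆ U := by
  refine ⟨(p '' Uᶜ)ᶜ, (hU.isClosed_compl.isCompact.image hc).isClosed.isOpen_compl, ?_, ?_⟩
  · exact nonempty_compl.mpr (hp _ (compl_ne_univ.mpr hne) hU.isClosed_compl)
  · intro x hx
    by_contra h
    exact hx ⟨x, h, rfl⟩

/-- An irreducible map has no nontrivial continuous self-maps over its target. -/
theorem IsIrreducibleMap.eq_id {G X : Type*} [TopologicalSpace G] [CompactSpace G] [T2Space G]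
    [TopologicalSpace X] [T2Space X] {p : G → X} (hp : IsIrreducibleMap p) (hc : Continuous p)
    (hs : Function.Surjective p) {g : G → G} (hg : Continuous g) (h : p ∘ g = p) : g = id := by
  funext x
  by_contra hx
  obtain ⟨U, W, hU, hW, hxU, hxW, hd⟩ := t2_separation (Ne.symm hx)
  -- Since `g` preserves fibres of `p`, a point `y` of `p ⁻¹' V` has `g y` in `p ⁻¹' V` as well,
  -- which puts `g y` in both `U` and `W`.
  obtain ⟨V, -, ⟨v, hv⟩, hVU⟩ := hp.exists_preimage_subset hc
    (hU.inter (hW.preimage hg)) ⟨x, hxU, hxW⟩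
  obtain ⟨y, rfl⟩ := hs v
  have h1 := hVU (show y ∈ p ⁻¹' V from hv)
  have h2 := hVU (show g y ∈ p ⁻¹' V by
    have := congrFun h y
    simp only [Function.comp_apply] at this
    simpa [this] using hv)
  exact hd.ne_of_mem h2.1 h1.2 rfl

/-- Every compact Hausdorff space has a Gleason cover. -/
theorem exists_gleason_cover (X : Type u) [TopologicalSpace X] [CompactSpace X] [T2Space X] :
    ∃ (G : Type u) (_ : TopologicalSpace G) (_ : CompactSpace G) (_ : T2Space G) (p : G → X),
      CompactT2.Projective G ∧ Continuous p ∧ Function.Surjective p ∧ IsIrreducibleMap p := by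
  -- Ultrafilters on `X` form the Stone–Čech compactification of the discrete set `X`, where
  -- continuous maps can be prescribed freely on principal ultrafilters. A minimal closed `E` that
  -- still covers `X` is a retract of this space.
  let q : Ultrafilter X → X := Ultrafilter.extend id
  have hq : Continuous q := continuous_ultrafilter_extend _
  have hqs : Function.Surjective q := fun x => ⟨pure x, ultrafilter_extend_pure _ _⟩
  obtain ⟨E, hE, hEs, hEi⟩ := exists_compact_surjective_zorn_subset hq hqs
  have hp : Continuous (E.domRestrict q) := hq.continuousOn.domRestrict
  have hps : Function.Surjective (E.domRestrict q) := fun x => by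
    obtain ⟨e, he, rfl⟩ := (hEs ▸ mem_univ x : x ∈ q '' E)
    exact ⟨⟨e, he⟩, rfl⟩
  have hirr : IsIrreducibleMap (E.domRestrict q) := hEi
  refine ⟨E, inferInstance, hE, inferInstance, E.domRestrict q, ?_, hp, hps, hirr⟩
  -- a lift of `q` along its restriction to `E` retracts the projective space onto `E`
  intro Y Z _ _ _ _ _ _ φ f hφ hf hfs
  obtain ⟨r, hr, hrq⟩ : ∃ r : Ultrafilter X → E, Continuous r ∧ E.domRestrict q ∘ r = q := by
    choose l hl using hps
    have hlc : Continuous (Ultrafilter.extend l) := continuous_ultrafilter_extend l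
    refine ⟨Ultrafilter.extend l, hlc, ?_⟩
    refine DenseRange.equalizer (denseRange_pure) (hp.comp hlc) hq ?_
    funext x
    simpa [Function.comp_apply, ultrafilter_extend_pure, q] using hl x
  have hid : r ∘ (Subtype.val : E → Ultrafilter X) = id := by
    refine hirr.eq_id hp hps (hr.comp continuous_subtype_val) ?_
    rw [← Function.comp_assoc, hrq]
    rfl
  choose l hl using hfs
  have hlc : Continuous (Ultrafilter.extend (l ∘ φ ∘ r ∘ pure)) := continuous_ultrafilter_extend _
  refine ⟨Ultrafilter.extend (l ∘ φ ∘ r ∘ pure) ∘ Subtype.val, hlc.comp continuous_subtype_val, ?_⟩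
  have : f ∘ Ultrafilter.extend (l ∘ φ ∘ r ∘ pure) = φ ∘ r := by
    refine DenseRange.equalizer (denseRange_pure) (hf.comp hlc) (hφ.comp hr) ?_
    funext x
    simp [Function.comp_apply, ultrafilter_extend_pure, hl]
  rw [← Function.comp_assoc, this, Function.comp_assoc, hid, Function.comp_id]

/-! ### Positivity without a chosen order -/

/-- An element of a C*-algebra is positive if it has the form `star b * b`. -/
def IsPos {A : Type*} [CStarAlgebra A] (x : A) : Prop := ∃ b : A, x = star b * b

section Pos

variable {A : Type*} [CStarAlgebra A] {B : Type*} [CStarAlgebra B]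

theorem isPos_iff_nonneg [PartialOrder A] [StarOrderedRing A] {x : A} : IsPos x ↔ 0 ≤ x :=
  CStarAlgebra.nonneg_iff_eq_star_mul_self.symm

theorem isPos_star_mul_self (b : A) : IsPos (star b * b) := ⟨b, rfl⟩

theorem isPos_one : IsPos (1 : A) := ⟨1, by simp⟩

theorem IsPos.map {F : Type*} [FunLike F A B] [MulHomClass F A B] [StarHomClass F A B] (f : F)
    {x : A} (hx : IsPos x) : IsPos (f x) := by
  obtain ⟨b, rfl⟩ := hx
  exact ⟨f b, by rw [map_mul, map_star]⟩

theorem IsPos.isSelfAdjoint {x : A} (hx : IsPos x) : IsSelfAdjoint x := by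
  obtain ⟨b, rfl⟩ := hx
  exact IsSelfAdjoint.star_mul_self b

theorem IsPos.sum {ι : Type*} (s : Finset ι) {f : ι → A} (hf : ∀ i ∈ s, IsPos (f i)) :
    IsPos (∑ i ∈ s, f i) := by
  let _ := CStarAlgebra.spectralOrder A
  let _ := CStarAlgebra.spectralOrderedRing A
  simp only [isPos_iff_nonneg] at hf ⊢
  exact Finset.sum_nonneg hf

theorem IsPos.antisymm {x : A} (h : IsPos x) (h' : IsPos (-x)) : x = 0 := by
  let _ := CStarAlgebra.spectralOrder A
  let _ := CStarAlgebra.spectralOrderedRing A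
  rw [isPos_iff_nonneg] at h h'
  exact le_antisymm (by simpa using h') h

theorem isPos_norm_smul_one_add {x : A} (hx : IsSelfAdjoint x) :
    IsPos (((‖x‖ : ℝ) : ℂ) • (1 : A) + x) := by
  let _ := CStarAlgebra.spectralOrder A
  let _ := CStarAlgebra.spectralOrderedRing A
  rw [isPos_iff_nonneg]
  have := hx.neg_algebraMap_norm_le_self
  rw [Algebra.algebraMap_eq_smul_one] at this
  rw [Complex.coe_smul, ← sub_nonneg.trans (Iff.rfl)]
  have h2 := neg_le_iff_add_nonneg'.mp this
  simpa using h2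

theorem isPos_complex {z : ℂ} : IsPos z ↔ 0 ≤ z := isPos_iff_nonneg

theorem IsPositiveMatrix.isPos_sum {k : ℕ} {M : Matrix (Fin k) (Fin k) A} (hM : IsPositiveMatrix M)
    (c : Fin k → A) : IsPos (∑ i, ∑ j, star (c i) * M i j * c j) := by
  obtain ⟨N, rfl⟩ := hM
  have : ∑ i, ∑ j, star (c i) * (Nᴴ * N) i j * c j =
      ∑ l, star (∑ i, N l i * c i) * (∑ j, N l j * c j) := by
    simp only [Matrix.mul_apply, Matrix.conjTranspose_apply, Finset.mul_sum, Finset.sum_mul,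
      star_sum, star_mul, mul_assoc]
    calc _ = ∑ i, ∑ l, ∑ j, star (c i) * (star (N l i) * (N l j * c j)) :=
          Finset.sum_congr rfl fun i _ => Finset.sum_comm
      _ = ∑ l, ∑ i, ∑ j, star (c i) * (star (N l i) * (N l j * c j)) := Finset.sum_comm
      _ = _ := Finset.sum_congr rfl fun l _ => Finset.sum_comm
  rw [this]
  exact IsPos.sum _ fun l _ => isPos_star_mul_self _

theorem IsPositiveMatrix.map {F : Type*} [FunLike F A B] [NonUnitalRingHomClass F A B]
    [StarHomClass F A B] (f : F) {k : ℕ} {M : Matrix (Fin k) (Fin k) A}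
    (hM : IsPositiveMatrix M) : IsPositiveMatrix (M.map f) := by
  obtain ⟨N, rfl⟩ := hM
  refine ⟨N.map f, ?_⟩
  ext i j
  simp [Matrix.mul_apply, map_sum, map_mul, map_star]

theorem IsUCP.map_isPos {S : Submodule ℂ A} {hS : IsOperatorSystem S} {φ : S →ₗ[ℂ] B}
    (hφ : IsUCP hS φ) {s : S} (hs : IsPos (s : A)) : IsPos (φ s) := by
  obtain ⟨b, hb⟩ := hs
  have h := hφ.map_pos 1 (Matrix.of fun _ _ => s) ⟨Matrix.of fun _ _ => b, by
    ext i j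
    simp [Matrix.mul_apply, hb]⟩
  simpa using h.isPos_sum (fun _ => 1)

end Pos

/-! ### Positive maps into commutative algebras -/

/-- A matrix of continuous functions that is pointwise positive semidefinite is positive. -/
theorem isPositiveMatrix_of_posSemidef {Z : Type*} [TopologicalSpace Z] [CompactSpace Z] {k : ℕ}
    (M : Matrix (Fin k) (Fin k) C(Z, ℂ)) (h : ∀ z, (M.map fun f => f z).PosSemidef) :
    IsPositiveMatrix M := by
  open scoped Matrix.Norms.L2Operator MatrixOrder in
  have hc : Continuous fun z => CFC.sqrt (M.map fun f => f z) := by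
    refine CFC.continuousOn_sqrt.comp_continuous ?_ fun z => (h z).nonneg
    refine continuous_matrix fun i j => ?_
    exact (M i j).continuous
  refine ⟨Matrix.of fun i j => ⟨fun z => CFC.sqrt (M.map fun f => f z) i j, hc.matrix_elem i j⟩, ?_⟩
  ext i j z
  have hsq : star (CFC.sqrt (M.map fun f => f z)) * CFC.sqrt (M.map fun f => f z) =
      M.map fun f => f z := by
    rw [(CFC.sqrt_nonneg (M.map fun f => f z)).isSelfAdjoint.star_eq]
    exact CFC.sqrt_mul_sqrt_self _ (h z).nonneg
  have := congrFun (congrFun hsq i) j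
  simp only [Matrix.mul_apply, Matrix.map_apply, Matrix.star_apply] at this
  simp [Matrix.mul_apply, ← this]

section Functional

variable {D : Type*} [CStarAlgebra D] {S : Submodule ℂ D}

theorem im_eq_zero_of_nonneg (hS : IsOperatorSystem S) {φ : S →ₗ[ℂ] ℂ}
    (hpos : ∀ s : S, IsPos (s : D) → 0 ≤ φ s) {s : S} (hs : IsSelfAdjoint (s : D)) : (φ s).im = 0 := by
  have h1 := hpos ⟨1, hS.one_mem⟩ isPos_one
  have h2 := hpos (((‖(s : D)‖ : ℝ) : ℂ) • ⟨1, hS.one_mem⟩ + s) (by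
    simpa using isPos_norm_smul_one_add hs)
  rw [map_add, map_smul] at h2
  have h1' := (Complex.nonneg_iff.mp h1).2
  have h2' := (Complex.nonneg_iff.mp h2).2
  simp only [smul_eq_mul, Complex.add_im, Complex.im_ofReal_mul, ← h1'] at h2'
  linarith

theorem realPart_mem (hS : IsOperatorSystem S) {d : D} (hd : d ∈ S) : (ℜ d : D) ∈ S := by
  rw [realPart_apply_coe, ← Complex.coe_smul]
  exact S.smul_mem _ (S.add_mem hd (hS.star_mem _ hd))

theorem imaginaryPart_mem (hS : IsOperatorSystem S) {d : D} (hd : d ∈ S) : (ℑ d : D) ∈ S := by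
  have := realPart_mem hS (S.smul_mem (-Complex.I) hd)
  rwa [neg_smul, map_neg, realPart_I_smul, neg_neg] at this

theorem map_star_of_nonneg (hS : IsOperatorSystem S) {φ : S →ₗ[ℂ] ℂ}
    (hpos : ∀ s : S, IsPos (s : D) → 0 ≤ φ s) (s : S) :
    φ ⟨star (s : D), hS.star_mem _ s.2⟩ = star (φ s) := by
  have e1 : s = ⟨(ℜ (s : D) : D), realPart_mem hS s.2⟩ +
      Complex.I • ⟨(ℑ (s : D) : D), imaginaryPart_mem hS s.2⟩ :=
    Subtype.ext (realPart_add_I_smul_imaginaryPart (s : D)).symm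
  have e2 : (⟨star (s : D), hS.star_mem _ s.2⟩ : S) = ⟨(ℜ (s : D) : D), realPart_mem hS s.2⟩ -
      Complex.I • ⟨(ℑ (s : D) : D), imaginaryPart_mem hS s.2⟩ := by
    refine Subtype.ext ?_
    change star (s : D) = _
    conv_lhs => rw [← realPart_add_I_smul_imaginaryPart (s : D)]
    simp [(ℜ (s : D)).2.star_eq, (ℑ (s : D)).2.star_eq, sub_eq_add_neg]
  have h1 := im_eq_zero_of_nonneg hS hpos (s := ⟨_, realPart_mem hS s.2⟩) (ℜ (s : D)).2
  have h2 := im_eq_zero_of_nonneg hS hpos (s := ⟨_, imaginaryPart_mem hS s.2⟩) (ℑ (s : D)).2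
  rw [e2]
  conv_rhs => rw [e1]
  simp only [map_sub, map_add, map_smul, smul_eq_mul]
  apply Complex.ext <;> simp [h1, h2]

end Functional

/-- A unital positive linear map into a commutative C*-algebra is completely positive. -/
theorem isUCP_of_nonneg {D : Type*} [CStarAlgebra D] {S : Submodule ℂ D} (hS : IsOperatorSystem S)
    {Z : Type*} [TopologicalSpace Z] [CompactSpace Z] (φ : S →ₗ[ℂ] C(Z, ℂ))
    (h1 : φ ⟨1, hS.one_mem⟩ = 1) (hpos : ∀ s : S, IsPos (s : D) → ∀ z, 0 ≤ φ s z) :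
    IsUCP hS φ := by
  refine ⟨h1, fun k M hM => isPositiveMatrix_of_posSemidef _ fun z => ?_⟩
  have hz : ∀ s : S, IsPos (s : D) →
      0 ≤ ((ContinuousMap.evalAlgHom ℂ ℂ z).toLinearMap ∘ₗ φ) s := fun s hs => hpos s hs z
  refine .of_dotProduct_mulVec_nonneg ?_ fun c => ?_
  · obtain ⟨N, hN⟩ := hM
    ext i j
    have h := map_star_of_nonneg hS hz (M j i)
    have hij : (⟨star (M j i : D), hS.star_mem _ (M j i).2⟩ : S) = M i j := by
      refine Subtype.ext ?_
      have h1 : (M i j : D) = (Nᴴ * N) i j := congrFun (congrFun hN i) j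
      have h2 : (M j i : D) = (Nᴴ * N) j i := congrFun (congrFun hN j) i
      change star (M j i : D) = M i j
      rw [h1, h2, ← Matrix.conjTranspose_apply, Matrix.conjTranspose_mul,
        Matrix.conjTranspose_conjTranspose]
    rw [hij] at h
    exact h.symm
  -- With the scalars `c i` placed in `D`, the quadratic form of the matrix is the functional
  -- applied to the single positive element `c* M c` of `S`.
  · have h := hz (∑ i, ∑ j, (star (c i) * c j) • M i j) (by
      have := hM.isPos_sum fun i => algebraMap ℂ D (c i)
      convert this using 1
      simp only [Submodule.coe_sum, Submodule.coe_smul, Matrix.map_apply]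
      refine Finset.sum_congr rfl fun i _ => Finset.sum_congr rfl fun j _ => ?_
      simp [Algebra.algebraMap_eq_smul_one, smul_smul, mul_comm])
    convert h using 1
    simp only [dotProduct, Matrix.mulVec, Finset.mul_sum, map_sum, map_smul]
    refine Finset.sum_congr rfl fun i _ => Finset.sum_congr rfl fun j _ => ?_
    simp
    ring
-- Injectivity of `C(G)` for projective `G`
/-- A positive functional on an operator system extends to the ambient C*-algebra. -/
theorem exists_nonneg_extension {D : Type*} [CStarAlgebra D] {S : Submodule ℂ D}
    (hS : IsOperatorSystem S) (φ : S →ₗ[ℂ] ℂ) (hpos : ∀ s : S, IsPos (s : D) → 0 ≤ φ s) :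
    ∃ ψ : D →ₗ[ℂ] ℂ, (∀ d, IsPos d → 0 ≤ ψ d) ∧ ∀ s : S, ψ s = φ s := by
  let _ := CStarAlgebra.spectralOrder D
  let _ := CStarAlgebra.spectralOrderedRing D
  let p : Submodule ℝ (selfAdjoint D) :=
    (S.restrictScalars ℝ).comap (selfAdjoint.submodule ℝ D).subtype
  let f : p →ₗ[ℝ] ℝ := Complex.reLm ∘ₗ (φ.restrictScalars ℝ) ∘ₗ
    ((selfAdjoint.submodule ℝ D).subtype.restrict (p := p) (q := S.restrictScalars ℝ)
      fun _ hx => hx)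
  let C : PointedCone ℝ (selfAdjoint D) :=
    { carrier := {x | 0 ≤ (x : D)}
      add_mem' := fun {a b} ha hb => by
        change 0 ≤ (a : D) + b
        exact add_nonneg ha hb
      zero_mem' := le_refl (0 : D)
      smul_mem' := fun c x hx => by
        change 0 ≤ (c : ℝ) • (x : D)
        exact smul_nonneg c.2 hx }
  -- M. Riesz extension on self-adjoint elements; its cofinality condition holds because `‖y‖ • 1 +
  -- y` is positive.
  obtain ⟨g, hg, hgC⟩ := riesz_extension C ⟨p, f⟩ (fun x hx => by
      have h := hpos ⟨((x : selfAdjoint D) : D), x.2⟩ (isPos_iff_nonneg.mpr hx)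
      exact (Complex.nonneg_iff.mp h).1) (fun y => by
      refine ⟨⟨⟨((‖(y : D)‖ : ℝ) : ℂ) • 1, ?_⟩, S.smul_mem _ hS.one_mem⟩, ?_⟩
      · simp [selfAdjoint.mem_iff]
      · exact isPos_iff_nonneg.mp (isPos_norm_smul_one_add y.2))
  have hre : ∀ s : S, g (ℜ (s : D)) = (φ s).re := fun s => by
    have h1 := hg ⟨ℜ (s : D), realPart_mem hS s.2⟩
    have h2 := im_eq_zero_of_nonneg hS hpos (s := ⟨_, imaginaryPart_mem hS s.2⟩) (ℑ (s : D)).2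
    have e1 : s = ⟨(ℜ (s : D) : D), realPart_mem hS s.2⟩ +
        Complex.I • ⟨(ℑ (s : D) : D), imaginaryPart_mem hS s.2⟩ :=
      Subtype.ext (realPart_add_I_smul_imaginaryPart (s : D)).symm
    refine h1.trans ?_
    conv_rhs => rw [e1]
    rw [map_add, map_smul]
    simp only [smul_eq_mul, Complex.add_re, Complex.I_mul_re, h2, neg_zero, add_zero]
    rfl
  refine ⟨Module.Dual.extendRCLike (g ∘ₗ realPart), fun d hd => ?_, fun s => ?_⟩
  · have hsa := hd.isSelfAdjoint
    have h1 : ℜ (Complex.I • d) = 0 := by rw [realPart_I_smul, hsa.imaginaryPart, neg_zero]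
    have h2 : 0 ≤ g (ℜ d) := hgC _ (by
      change 0 ≤ (ℜ d : D)
      rw [hsa.coe_realPart]
      exact isPos_iff_nonneg.mp hd)
    rw [Module.Dual.extendRCLike_apply]
    simpa [h1] using h2
  · rw [Module.Dual.extendRCLike_apply]
    have h1 := hre s
    have h2 := hre (Complex.I • s)
    apply Complex.ext
    · simp [h1]
    · have h3 : g (ℜ (Complex.I • (s : D))) = -(φ s).im := by
        rw [← Submodule.coe_smul, h2]
        simp
      simp [-realPart_I_smul, h3]

/-- The factor 2 comes from treating real and imaginary parts separately; only a bound uniform over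
such functionals is needed. -/
theorem norm_le_of_nonneg {D : Type*} [CStarAlgebra D] (ψ : D →ₗ[ℂ] ℂ)
    (hpos : ∀ d, IsPos d → 0 ≤ ψ d) (h1 : ψ 1 = 1) (d : D) : ‖ψ d‖ ≤ 2 * ‖d‖ := by
  have hsa : ∀ x : D, IsSelfAdjoint x → ‖ψ x‖ ≤ ‖x‖ := fun x hx => by
    have h2 := hpos _ (isPos_norm_smul_one_add hx)
    have h3 := hpos _ (isPos_norm_smul_one_add hx.neg)
    rw [map_add, map_smul, h1] at h2 h3
    rw [map_neg, norm_neg] at h3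
    have h2' := Complex.nonneg_iff.mp h2
    have h3' := Complex.nonneg_iff.mp h3
    simp at h2' h3'
    have him : (ψ x).im = 0 := h2'.2.symm
    have : ψ x = ((ψ x).re : ℂ) := Complex.ext rfl (by simp [him])
    rw [this, Complex.norm_real, Real.norm_eq_abs, abs_le]
    constructor <;> linarith [h2'.1, h3'.1]
  conv_lhs => rw [← realPart_add_I_smul_imaginaryPart d]
  rw [map_add, map_smul]
  refine (norm_add_le _ _).trans ?_
  rw [norm_smul, Complex.norm_I, one_mul, two_mul]
  exact add_le_add ((hsa _ (ℜ d).2).trans (realPart.norm_le d))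
    ((hsa _ (ℑ d).2).trans (imaginaryPart.norm_le d))

/-- No continuity of `h` is needed: a bounded function takes values in a compact disc, so it extends
continuously to all ultrafilters, and `s` pulls the extension back to `G`. -/
theorem exists_continuous_limit {G : Type*} [TopologicalSpace G] {s : G → Ultrafilter G}
    (hs : Continuous s) (h : G → ℂ) {R : ℝ} (hR : ∀ g, ‖h g‖ ≤ R) :
    ∃ F : C(G, ℂ), ∀ g, Tendsto h (s g) (𝓝 (F g)) := by
  let h' : G → Metric.closedBall (0 : ℂ) R := fun g => ⟨h g, by simpa using hR g⟩
  have : CompactSpace (Metric.closedBall (0 : ℂ) R) :=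
    isCompact_iff_compactSpace.mp (isCompact_closedBall _ _)
  refine ⟨⟨Subtype.val ∘ Ultrafilter.extend h' ∘ s,
    continuous_subtype_val.comp ((continuous_ultrafilter_extend h').comp hs)⟩, fun g => ?_⟩
  have h1 : Tendsto h' (s g) (𝓝 (Ultrafilter.extend h' (s g))) := by
    simpa [Tendsto] using ultrafilter_extend_eq_iff.mp (rfl : Ultrafilter.extend h' (s g) = _)
  exact (continuous_subtype_val.tendsto _).comp h1

/-- Continuous functions on a projective compact Hausdorff space form an injective C*-algebra. -/
theorem isInjective_of_projective (G : Type u) [TopologicalSpace G] [CompactSpace G] [T2Space G]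
    (hG : CompactT2.Projective G) : IsInjective C(G, ℂ) := by
  intro D _ S T hS hT hST φ hφ
  -- Projectivity splits the limit map on ultrafilters: `s g` converges to `g` and depends
  -- continuously on `g`.
  obtain ⟨s, hs, hsec⟩ := hG (f := (id : G → G)) (g := (Ultrafilter.extend id : Ultrafilter G → G))
    continuous_id (continuous_ultrafilter_extend _) fun x => ⟨pure x, ultrafilter_extend_pure _ _⟩
  have hsg : ∀ g, Tendsto id (s g : Filter G) (𝓝 g) := fun g => by
    simpa [Tendsto] using ultrafilter_extend_eq_iff.mp (congrFun hsec g)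
  -- The extensions are chosen independently at each point. Limits along `s g` make them continuous
  -- in `g`, keeping linearity, positivity and the values on `S`.
  have hst : ∀ g : G, ∃ ψ : D →ₗ[ℂ] ℂ, (∀ d, IsPos d → 0 ≤ ψ d) ∧ ∀ x : S, ψ x = φ x g := fun g => by
    refine exists_nonneg_extension hS ((ContinuousMap.evalAlgHom ℂ ℂ g).toLinearMap ∘ₗ φ) ?_
    intro x hx
    exact isPos_complex.mp ((hφ.map_isPos hx).map (ContinuousMap.evalStarAlgHom ℂ ℂ g))
  choose ψ hψ hψe using hst
  have hψ1 : ∀ g, ψ g 1 = 1 := fun g => by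
    have := hψe g ⟨1, hS.one_mem⟩
    rw [hφ.map_one] at this
    simpa using this
  have hlim : ∀ d : D, ∃ F : C(G, ℂ), ∀ g, Tendsto (fun x => ψ x d) (s g) (𝓝 (F g)) := fun d =>
    exists_continuous_limit hs (fun x => ψ x d)
      (fun x => norm_le_of_nonneg (ψ x) (hψ x) (hψ1 x) d)
  choose F hF using hlim
  let Ψ : D →ₗ[ℂ] C(G, ℂ) :=
    { toFun := F
      map_add' := fun a b => by
        ext g
        refine tendsto_nhds_unique (hF (a + b) g) ?_
        simpa using (hF a g).add (hF b g)
      map_smul' := fun c a => by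
        ext g
        refine tendsto_nhds_unique (hF (c • a) g) ?_
        simpa using (hF a g).const_mul c }
  have hΨ : ∀ x : S, Ψ x = φ x := fun x => by
    ext g
    refine tendsto_nhds_unique (hF x g) ?_
    simp only [hψe]
    exact ((φ x).continuous.tendsto g).comp (hsg g)
  refine ⟨Ψ ∘ₗ T.subtype, isUCP_of_nonneg hT _ ?_ ?_, fun x => hΨ x⟩
  · have := hΨ ⟨1, hS.one_mem⟩
    rw [hφ.map_one] at this
    exact this
  · intro x hx g
    exact ge_of_tendsto' (hF x g) fun y => hψ y x hx

/-! ### Rigidity of the Gleason cover -/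

/-- A real-valued continuous function, seen as a complex-valued one. -/
noncomputable def ofRealMap {G : Type*} [TopologicalSpace G] (f : C(G, ℝ)) : C(G, ℂ) :=
  (⟨Complex.ofReal, Complex.continuous_ofReal⟩ : C(ℝ, ℂ)).comp f

theorem ofRealMap_apply {G : Type*} [TopologicalSpace G] (f : C(G, ℝ)) (g : G) :
    ofRealMap f g = (f g : ℂ) := rfl

theorem isPos_continuousMap {G : Type*} [TopologicalSpace G] [CompactSpace G] {f : C(G, ℂ)} :
    IsPos f ↔ ∀ g, 0 ≤ f g := by
  rw [isPos_iff_nonneg, ContinuousMap.le_def]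
  rfl

theorem isPos_ofRealMap {G : Type*} [TopologicalSpace G] [CompactSpace G] {f : C(G, ℝ)} :
    IsPos (ofRealMap f) ↔ ∀ g, 0 ≤ f g := by
  simp [isPos_continuousMap, ofRealMap_apply]

section Rigid

variable {G X : Type*} [TopologicalSpace G] [CompactSpace G]
  [TopologicalSpace X] [CompactSpace X] [T2Space X]

/-- If `φ f < c < f` somewhere, this holds on all of `p ⁻¹' V` for some nonempty open `V`. A
function `a` on `X` that peaks at `c` inside `V` and is very negative off `V` has `a ∘ p ≤ f`, so `a
∘ p ≤ φ f`, which fails over the peak. -/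
theorem IsIrreducibleMap.le_of_fixed {p : C(G, X)} (hp : IsIrreducibleMap p)
    (hs : Function.Surjective p) {φ : C(G, ℂ) →ₗ[ℂ] C(G, ℂ)} (hpos : ∀ f, IsPos f → IsPos (φ f))
    (hfix : ∀ a : C(X, ℂ), φ (a.comp p) = a.comp p) (f : C(G, ℝ)) (g : G) :
    f g ≤ (φ (ofRealMap f) g).re := by
  by_contra! hlt
  obtain ⟨c, hc1, hc2⟩ := exists_between hlt
  have hU : IsOpen {g | (φ (ofRealMap f) g).re < c ∧ c < f g} :=
    (isOpen_lt (Complex.continuous_re.comp (φ (ofRealMap f)).continuous) continuous_const).inter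
      (isOpen_lt continuous_const f.continuous)
  obtain ⟨V, hV, ⟨x, hx⟩, hVU⟩ := hp.exists_preimage_subset p.continuous hU ⟨g, hc1, hc2⟩
  obtain ⟨w, hw0, hw1, hw⟩ := exists_continuous_zero_one_of_isClosed hV.isClosed_compl
    (isClosed_singleton (x := x)) (disjoint_singleton_right.mpr (by simpa using hx))
  -- `-‖f‖` puts `a ∘ p` below `f` off `V`; the minimum with `c` ensures `a ≤ c` everywhere.
  let m : ℝ := min c (-‖f‖)
  let a : C(X, ℝ) := ContinuousMap.const X m + (c - m) • w
  have ha : ∀ y, a y = m + (c - m) * w y := fun y => rfl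
  have hmc : m ≤ c := min_le_left _ _
  have hle : IsPos (ofRealMap (f - a.comp p)) := by
    rw [isPos_ofRealMap]
    intro y
    simp only [ContinuousMap.sub_apply, ContinuousMap.comp_apply, sub_nonneg, ha]
    by_cases hy : p y ∈ V
    · have h1 := (hVU hy).2
      nlinarith [(hw (p y)).2]
    · have h1 : w (p y) = 0 := hw0 hy
      have h2 : m ≤ -‖f‖ := min_le_right _ _
      have h3 := (abs_le.mp (f.norm_coe_le_norm y)).1
      rw [h1]
      linarith
  obtain ⟨y, rfl⟩ := hs x
  have h1 := isPos_continuousMap.mp (hpos _ hle) y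
  have h2 : ofRealMap (f - a.comp p) = ofRealMap f - (ofRealMap a).comp p := by
    ext z
    simp [ofRealMap_apply]
  rw [h2, map_sub, hfix] at h1
  have h3 := (Complex.nonneg_iff.mp h1).1
  have h4 : w (p y) = 1 := hw1 rfl
  simp only [ContinuousMap.sub_apply, Complex.sub_re, ContinuousMap.comp_apply, ofRealMap_apply,
    Complex.ofReal_re, ha, h4] at h3
  have h5 := (hVU (show y ∈ p ⁻¹' V from hx)).1
  linarith

/-- The inclusion of function algebras induced by an irreducible map is rigid. -/
theorem IsIrreducibleMap.eq_id_of_fixed {p : C(G, X)} (hp : IsIrreducibleMap p)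
    (hs : Function.Surjective p) {φ : C(G, ℂ) →ₗ[ℂ] C(G, ℂ)} (hpos : ∀ f, IsPos f → IsPos (φ f))
    (hfix : ∀ a : C(X, ℂ), φ (a.comp p) = a.comp p) : φ = LinearMap.id := by
  have h1 : φ 1 = 1 := hfix 1
  have hreal : ∀ f : C(G, ℝ), φ (ofRealMap f) = ofRealMap f := fun f => by
    ext g
    apply Complex.ext
    · refine le_antisymm ?_ (hp.le_of_fixed hs hpos hfix f g)
      have h := hp.le_of_fixed hs hpos hfix (-f) g
      have h2 : ofRealMap (-f) = -ofRealMap f := by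
        ext z
        simp [ofRealMap_apply]
      rw [h2, map_neg] at h
      simpa [ofRealMap_apply] using h
    · have hsa : IsSelfAdjoint (ofRealMap f) := by
        ext z
        simp [ofRealMap_apply]
      have h := isPos_continuousMap.mp (hpos _ (isPos_norm_smul_one_add hsa)) g
      rw [map_add, map_smul, h1] at h
      simpa [ofRealMap_apply, eq_comm] using (Complex.nonneg_iff.mp h).2
  refine LinearMap.ext fun f => ?_
  have hf : f = ofRealMap ⟨fun g => (f g).re, Complex.continuous_re.comp f.continuous⟩ +
      Complex.I • ofRealMap ⟨fun g => (f g).im, Complex.continuous_im.comp f.continuous⟩ := by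
    ext g
    apply Complex.ext <;> simp [ofRealMap_apply]
  rw [hf]
  simp [hreal]

end Rigid

/-! ### Kadison–Schwarz and multiplicativity -/

section Ucp

variable {A : Type*} [CStarAlgebra A] {B : Type*} [CStarAlgebra B] {E : Type*} [CStarAlgebra E]

theorem IsUCP.comp {φ : A →ₗ[ℂ] B} (hφ : IsUCP isOperatorSystem_top (φ.domRestrict ⊤))
    {ψ : B →ₗ[ℂ] E} (hψ : IsUCP isOperatorSystem_top (ψ.domRestrict ⊤)) :
    IsUCP isOperatorSystem_top ((ψ ∘ₗ φ).domRestrict ⊤) := by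
  refine ⟨?_, fun k M hM => ?_⟩
  · have h1 : φ 1 = 1 := hφ.map_one
    have h2 : ψ 1 = 1 := hψ.map_one
    change ψ (φ 1) = 1
    rw [h1, h2]
  · exact hψ.map_pos k (M.map fun s => ⟨φ s, trivial⟩) (hφ.map_pos k M hM)

theorem IsUCP.comp_starAlgHom {S : Submodule ℂ A} {hS : IsOperatorSystem S} {φ : S →ₗ[ℂ] B}
    (hφ : IsUCP hS φ) (f : B →⋆ₐ[ℂ] E) : IsUCP hS (f.toAlgHom.toLinearMap ∘ₗ φ) := by
  refine ⟨?_, fun k M hM => ?_⟩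
  · change f (φ ⟨1, hS.one_mem⟩) = 1
    rw [hφ.map_one, _root_.map_one]
  · exact (hφ.map_pos k M hM).map f

theorem IsUCP.isPos_map {φ : A →ₗ[ℂ] B} (hφ : IsUCP isOperatorSystem_top (φ.domRestrict ⊤))
    {x : A} (hx : IsPos x) : IsPos (φ x) :=
  hφ.map_isPos (s := ⟨x, trivial⟩) hx

/-- The source matrix is `Nᴴ * N` for `N = !![1, x; 0, 0]`. Its image yields both preservation of
adjoints and Kadison–Schwarz. -/
theorem IsUCP.isPositiveMatrix_two {φ : A →ₗ[ℂ] B}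
    (hφ : IsUCP isOperatorSystem_top (φ.domRestrict ⊤)) (x : A) :
    IsPositiveMatrix !![1, φ x; φ (star x), φ (star x * x)] := by
  have h1 : φ 1 = 1 := hφ.map_one
  have h := hφ.map_pos 2 (Matrix.of fun i j => ⟨!![1, x; star x, star x * x] i j, trivial⟩)
    ⟨!![1, x; 0, 0], by
      ext i j
      fin_cases i <;> fin_cases j <;> simp [Matrix.mul_apply]⟩
  convert h using 1
  ext i j
  fin_cases i <;> fin_cases j <;> simp [h1]

theorem IsUCP.map_star {φ : A →ₗ[ℂ] B}
    (hφ : IsUCP isOperatorSystem_top (φ.domRestrict ⊤)) (x : A) : φ (star x) = star (φ x) := by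
  obtain ⟨N, hN⟩ := hφ.isPositiveMatrix_two x
  have h1 := congrFun (congrFun hN 1) 0
  have h2 := congrFun (congrFun hN 0) 1
  simp only [Matrix.of_apply, Matrix.cons_val', Matrix.cons_val_zero, Matrix.cons_val_one,
    Matrix.cons_val_fin_one] at h1 h2
  rw [h1, h2, ← Matrix.conjTranspose_apply, Matrix.conjTranspose_mul,
    Matrix.conjTranspose_conjTranspose]

/-- The Kadison–Schwarz inequality. -/
theorem IsUCP.kadison_schwarz {φ : A →ₗ[ℂ] B}
    (hφ : IsUCP isOperatorSystem_top (φ.domRestrict ⊤)) (x : A) :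
    IsPos (φ (star x * x) - star (φ x) * φ x) := by
  have h := (hφ.isPositiveMatrix_two x).isPos_sum ![-φ x, 1]
  convert h using 1
  simp [Fin.sum_univ_two, hφ.map_star, sub_eq_add_neg, add_comm]

/-- A unital completely positive map with a unital completely positive inverse is
multiplicative. -/
theorem IsUCP.map_mul_of_inverse {φ : A →ₗ[ℂ] B}
    (hφ : IsUCP isOperatorSystem_top (φ.domRestrict ⊤)) {ψ : B →ₗ[ℂ] A}
    (hψ : IsUCP isOperatorSystem_top (ψ.domRestrict ⊤)) (h1 : ψ ∘ₗ φ = LinearMap.id)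
    (h2 : φ ∘ₗ ψ = LinearMap.id) (x y : A) : φ (x * y) = φ x * φ y := by
  have h1' : ∀ a, ψ (φ a) = a := fun a => LinearMap.congr_fun h1 a
  have h2' : ∀ b, φ (ψ b) = b := fun b => LinearMap.congr_fun h2 b
  -- Kadison–Schwarz for `φ` gives one inequality; `φ` applied to Kadison–Schwarz for `ψ` at `φ x`
  -- gives the other. Polarisation then finishes.
  have hsq : ∀ x, φ (star x * x) = star (φ x) * φ x := fun x => by
    rw [← sub_eq_zero]
    refine (hφ.kadison_schwarz x).antisymm ?_
    have h := hφ.isPos_map (hψ.kadison_schwarz (φ x))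
    rw [map_sub, h1', h2'] at h
    simpa using h
  have hpol : ∀ x y, φ (star x * y) = star (φ x) * φ y := fun x y => by
    have e1 := hsq (x + y)
    have e2 := hsq (x + Complex.I • y)
    simp only [star_add, add_mul, mul_add, map_add, star_smul, smul_mul_assoc, mul_smul_comm,
      map_smul, hsq] at e1 e2
    simp at e2
    have e3 : φ (star x * y) + φ (star y * x) = star (φ x) * φ y + star (φ y) * φ x := by
      linear_combination (norm := module) e1
    have e4 : Complex.I • (φ (star x * y) - φ (star y * x)) =
        Complex.I • (star (φ x) * φ y - star (φ y) * φ x) := by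
      rw [smul_sub, smul_sub]
      linear_combination (norm := module) e2
    have e5 := smul_right_injective B Complex.I_ne_zero e4
    have e6 : (2 : ℂ) • φ (star x * y) = (2 : ℂ) • (star (φ x) * φ y) := by
      rw [two_smul, two_smul]
      linear_combination (norm := module) e3 + e5
    exact smul_right_injective B two_ne_zero e6
  have := hpol (star x) y
  rwa [star_star, hφ.map_star, star_star] at this

/-- A unital completely positive map with a unital completely positive inverse is a
*-homomorphism. -/
noncomputable def IsUCP.toStarAlgHom {φ : A →ₗ[ℂ] B}
    (hφ : IsUCP isOperatorSystem_top (φ.domRestrict ⊤)) {ψ : B →ₗ[ℂ] A}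
    (hψ : IsUCP isOperatorSystem_top (ψ.domRestrict ⊤)) (h1 : ψ ∘ₗ φ = LinearMap.id)
    (h2 : φ ∘ₗ ψ = LinearMap.id) : A →⋆ₐ[ℂ] B :=
  { AlgHom.ofLinearMap φ hφ.map_one (hφ.map_mul_of_inverse hψ h1 h2) with
    map_star' := hφ.map_star }

/-- For the negative part `n` of `a`, `n * a * n = -n³`. Both `n³` and, after `ι`, its negative are
positive, so `n³ = 0` and hence `n = 0`. -/
theorem isPos_of_map (ι : A →⋆ₐ[ℂ] B) (hι : Function.Injective ι) {a : A} (ha : IsPos (ι a)) :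
    IsPos a := by
  let _ := CStarAlgebra.spectralOrder A
  let _ := CStarAlgebra.spectralOrderedRing A
  have hsa : IsSelfAdjoint a := hι (by rw [map_star, ha.isSelfAdjoint.star_eq])
  have hn : 0 ≤ a⁻ := CFC.negPart_nonneg a
  have hns : star a⁻ = a⁻ := (IsSelfAdjoint.of_nonneg hn).star_eq
  have hcube : a⁻ * a * a⁻ = -(a⁻ * a⁻ * a⁻) := by
    conv_lhs => enter [1, 2]; rw [← CFC.posPart_sub_negPart a hsa]
    rw [mul_sub, sub_mul, CFC.negPart_mul_posPart]
    simp
  have h1 : IsPos (a⁻ * a⁻ * a⁻) := by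
    have := star_left_conjugate_nonneg hn a⁻
    rwa [hns, ← isPos_iff_nonneg] at this
  have h2 : IsPos (-ι (a⁻ * a⁻ * a⁻)) := by
    obtain ⟨b, hb⟩ := ha
    refine ⟨b * ι a⁻, ?_⟩
    rw [← map_neg, ← hcube, star_mul, ← map_star, hns, map_mul, map_mul, hb]
    simp only [mul_assoc]
  have h3 : a⁻ * a⁻ * a⁻ = 0 := hι (by rw [(h1.map ι).antisymm h2, map_zero])
  have h4 : a⁻ * a⁻ = 0 := by
    rw [← CStarRing.star_mul_self_eq_zero_iff, star_mul, hns, ← mul_assoc, h3, zero_mul]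
  have h5 : a⁻ = 0 := by
    rw [← CStarRing.star_mul_self_eq_zero_iff, hns, h4]
  rw [isPos_iff_nonneg, ← CFC.posPart_sub_negPart a hsa, h5, sub_zero]
  exact CFC.posPart_nonneg a

end Ucp

/-! ### Existence and uniqueness of the envelope -/

/-- The inverse of `ι` on its range is positive by `isPos_of_map`. Viewed in `C(X)` through the
Gelfand transform it is completely positive, so `κ ∘ ι⁻¹` is u.c.p. and extends by injectivity of
`E`. -/
theorem exists_ucp_extension {A D E : Type u} [CommCStarAlgebra A] [CStarAlgebra D] [CStarAlgebra E]
    (ι : A →⋆ₐ[ℂ] D) (hι : Function.Injective ι) (κ : A →⋆ₐ[ℂ] E) (hE : IsInjective E) :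
    ∃ α : D →ₗ[ℂ] E, IsUCP isOperatorSystem_top (α.domRestrict ⊤) ∧ ∀ a, α (ι a) = κ a := by
  let e := LinearEquiv.ofInjective ι.toAlgHom.toLinearMap hι
  have hS : IsOperatorSystem (LinearMap.range ι.toAlgHom.toLinearMap) :=
    ⟨⟨1, map_one ι⟩, fun _ ⟨a, ha⟩ => ⟨star a, by rw [← ha]; exact map_star ι a⟩⟩
  let Γ := gelfandStarTransform A
  let φ : LinearMap.range ι.toAlgHom.toLinearMap →ₗ[ℂ] C(WeakDual.characterSpace ℂ A, ℂ) :=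
    (Γ : A →⋆ₐ[ℂ] _).toAlgHom.toLinearMap ∘ₗ e.symm.toLinearMap
  have hφe : ∀ a, φ (e a) = Γ a := fun a => by simp [φ]
  have hφ : IsUCP hS φ := by
    refine isUCP_of_nonneg hS φ ?_ fun s hs => isPos_continuousMap.mp ?_
    · have : (⟨1, hS.one_mem⟩ : LinearMap.range ι.toAlgHom.toLinearMap) = e 1 :=
        Subtype.ext (map_one ι).symm
      rw [this, hφe, map_one]
    · obtain ⟨a, rfl⟩ := e.surjective s
      rw [hφe]
      exact (isPos_of_map ι hι hs).map Γ
  obtain ⟨ψ, hψ, hext⟩ := hE D _ ⊤ hS isOperatorSystem_top le_top _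
    (hφ.comp_starAlgHom (κ.comp (Γ.symm : _ →⋆ₐ[ℂ] A)))
  refine ⟨ψ ∘ₗ (LinearEquiv.ofTop ⊤ rfl).symm.toLinearMap, ?_, fun a => ?_⟩
  · exact hψ
  · refine (hext (e a)).trans ?_
    change κ (Γ.symm (φ (e a))) = κ a
    rw [hφe, StarAlgEquiv.symm_apply_apply]

/-- The inclusion of a commutative C*-algebra in the functions on a cover of its spectrum. -/
noncomputable def coverHom {A : Type*} [CommCStarAlgebra A] {G : Type*} [TopologicalSpace G]
    [CompactSpace G] (p : C(G, WeakDual.characterSpace ℂ A)) : A →⋆ₐ[ℂ] C(G, ℂ) :=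
  (ContinuousMap.compStarAlgHom' ℂ ℂ p).comp (gelfandStarTransform A : A →⋆ₐ[ℂ] _)

theorem isInjectiveEnvelope_coverHom {A G : Type u} [CommCStarAlgebra A] [TopologicalSpace G]
    [CompactSpace G] [T2Space G] (p : C(G, WeakDual.characterSpace ℂ A))
    (hG : CompactT2.Projective G) (hs : Function.Surjective p) (hp : IsIrreducibleMap p) :
    IsInjectiveEnvelope (coverHom p) := by
  refine ⟨fun a b hab => ?_, isInjective_of_projective G hG, fun φ hφ hfix => ?_⟩
  · refine (gelfandStarTransform A).injective (ContinuousMap.ext fun x => ?_)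
    obtain ⟨g, rfl⟩ := hs x
    exact congrArg (fun f : C(G, ℂ) => f g) hab
  · refine hp.eq_id_of_fixed hs (fun f hf => hφ.isPos_map hf) fun a => ?_
    obtain ⟨b, rfl⟩ := (gelfandStarTransform A).surjective a
    exact hfix b

/-- Injective envelopes of a commutative C*-algebra are unique. -/
theorem IsInjectiveEnvelope.exists_starAlgHom {A E F : Type u} [CommCStarAlgebra A]
    [CStarAlgebra E] [CStarAlgebra F] {κ : A →⋆ₐ[ℂ] E} (hκ : IsInjectiveEnvelope κ)
    {μ : A →⋆ₐ[ℂ] F} (hμ : IsInjectiveEnvelope μ) :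
    ∃ θ : E →⋆ₐ[ℂ] F, Function.Injective θ ∧ ∀ a, θ (κ a) = μ a := by
  obtain ⟨α, hα, hακ⟩ := exists_ucp_extension κ hκ.injective μ hμ.isInjective
  obtain ⟨β, hβ, hβμ⟩ := exists_ucp_extension μ hμ.injective κ hκ.isInjective
  -- Both composites fix the copy of `A`, so rigidity makes them identities.
  have h1 : β ∘ₗ α = LinearMap.id := hκ.rigid _ (hα.comp hβ) fun a => by simp [hακ, hβμ]
  have h2 : α ∘ₗ β = LinearMap.id := hμ.rigid _ (hβ.comp hα) fun a => by simp [hακ, hβμ]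
  exact ⟨hα.toStarAlgHom hβ h1 h2,
    Function.LeftInverse.injective (g := β) fun a => LinearMap.congr_fun h1 a, hακ⟩

/-! ### Monotone completeness of injective algebras -/

/-- An injective C*-algebra has a generalized limit along each directed set. -/
theorem exists_generalized_limit {B : Type u} [CStarAlgebra B] (hB : IsInjective B) (I : Type u)
    [Preorder I] [IsDirectedOrder I] [Nonempty I] [TopologicalSpace I] :
    ∃ Φ : (I →ᵇ B) →ₗ[ℂ] B, (∀ x, IsPos x → IsPos (Φ x)) ∧
      ∀ x b, (∀ᶠ i in atTop, x i = b) → Φ x = b := by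
  let S : Submodule ℂ (I →ᵇ B) :=
    { carrier := {x | ∃ b, ∀ᶠ i in atTop, x i = b}
      add_mem' := by
        rintro x y ⟨b, hb⟩ ⟨c, hc⟩
        exact ⟨b + c, by filter_upwards [hb, hc] with i h1 h2; simp [h1, h2]⟩
      zero_mem' := ⟨0, by simp⟩
      smul_mem' := by
        rintro c x ⟨b, hb⟩
        exact ⟨c • b, by filter_upwards [hb] with i h1; simp [h1]⟩ }
  have hS : IsOperatorSystem S := by
    refine ⟨⟨1, by simp⟩, ?_⟩
    rintro x ⟨b, hb⟩
    exact ⟨star b, by filter_upwards [hb] with i h1; simp [h1]⟩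
  have huniq : ∀ {x : I →ᵇ B} {b c : B}, (∀ᶠ i in atTop, x i = b) → (∀ᶠ i in atTop, x i = c) →
      b = c := by
    intro x b c hb hc
    obtain ⟨i, h1, h2⟩ := (hb.and hc).exists
    exact h1.symm.trans h2
  choose L hL using fun s : S => (s.2 : ∃ b, ∀ᶠ i in atTop, (s : I →ᵇ B) i = b)
  let φ : S →ₗ[ℂ] B :=
    { toFun := L
      map_add' := fun x y => huniq (hL _) (by
        filter_upwards [hL x, hL y] with i h1 h2
        simp [h1, h2])
      map_smul' := fun c x => huniq (hL _) (by
        filter_upwards [hL x] with i h1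
        simp [h1]) }
  have hφ : IsUCP hS φ := by
    refine ⟨huniq (hL _) (by simp), fun k M hM => ?_⟩
    obtain ⟨N, hN⟩ := hM
    -- Finitely many entries have all reached their eventual values at one index `i`; evaluation at
    -- `i` is a *-homomorphism, so `N` evaluated there is the witness.
    obtain ⟨i, hi⟩ := (eventually_all.mpr fun a => eventually_all.mpr fun b => hL (M a b)).exists
    refine ⟨N.map fun x => x i, ?_⟩
    ext a b
    have h1 : (M a b : I →ᵇ B) i = (Nᴴ * N) a b i :=
      congrArg (fun x : I →ᵇ B => x i) (congrFun (congrFun hN a) b)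
    rw [hi] at h1
    refine h1.trans ?_
    simp [Matrix.mul_apply]
  obtain ⟨ψ, hψ, hext⟩ := hB _ S ⊤ hS isOperatorSystem_top le_top φ hφ
  refine ⟨ψ ∘ₗ (LinearEquiv.ofTop ⊤ rfl).symm.toLinearMap, fun x hx => ?_, fun x b hb => ?_⟩
  · exact hψ.map_isPos (s := ⟨x, trivial⟩) hx
  · exact (hext ⟨x, b, hb⟩).trans (huniq (hL _) hb)

/-- Injective C*-algebras are monotone complete. -/
theorem exists_isLUB_of_injective {B : Type u} [CStarAlgebra B] [PartialOrder B] [StarOrderedRing B]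
    (hB : IsInjective B) {I : Type u} [Preorder I] [IsDirectedOrder I] [Nonempty I]
    {x : I → B} (hx : Monotone x) {R : ℝ} (hR : ∀ i, ‖x i‖ ≤ R) : ∃ s, IsLUB (range x) s := by
  let _ : TopologicalSpace I := ⊥
  have : DiscreteTopology I := ⟨rfl⟩
  obtain ⟨Φ, hpos, hlim⟩ := exists_generalized_limit hB I
  -- An eventually positive `y` differs from a globally positive `star z * z` by an eventually zero
  -- function, which `Φ` kills.
  have hnonneg : ∀ y : I →ᵇ B, (∀ᶠ i in atTop, 0 ≤ y i) → 0 ≤ Φ y := fun y hy => by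
    classical
    let z : I →ᵇ B := BoundedContinuousFunction.ofNormedAddCommGroupDiscrete
      (fun i => if 0 ≤ y i then CFC.sqrt (y i) else 0) (√‖y‖) (fun i => by
        split_ifs with h
        · rw [CFC.norm_sqrt _ h]
          exact Real.sqrt_le_sqrt (y.norm_coe_le_norm i)
        · simp)
    have h0 : Φ (y - star z * z) = 0 := hlim _ _ (by
      filter_upwards [hy] with i hi
      have hz : z i = CFC.sqrt (y i) := if_pos hi
      have : star (CFC.sqrt (y i)) = CFC.sqrt (y i) :=
        (IsSelfAdjoint.of_nonneg (CFC.sqrt_nonneg (y i))).star_eq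
      simp [hz, this, CFC.sqrt_mul_sqrt_self (y i) hi])
    rw [map_sub, sub_eq_zero] at h0
    rw [h0]
    exact isPos_iff_nonneg.mp (hpos _ (isPos_star_mul_self z))
  let X : I →ᵇ B := BoundedContinuousFunction.ofNormedAddCommGroupDiscrete x R hR
  have hconst : ∀ b, Φ (BoundedContinuousFunction.const I b) = b := fun b => hlim _ _ (by simp)
  refine ⟨Φ X, ?_, fun c hc => ?_⟩
  · rintro _ ⟨i, rfl⟩
    have := hnonneg (X - BoundedContinuousFunction.const I (x i)) (by
      filter_upwards [eventually_ge_atTop i] with j hj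
      exact sub_nonneg.mpr (hx hj))
    rwa [map_sub, hconst, sub_nonneg] at this
  · have := hnonneg (BoundedContinuousFunction.const I c - X)
      (Eventually.of_forall fun i => sub_nonneg.mpr (hc ⟨i, rfl⟩))
    rwa [map_sub, hconst, sub_nonneg] at this

/-! ### Bicommutants and extremally disconnected spectra -/

/-- Conjugation by `u` is an order automorphism fixing each element of `X`, so it fixes the
supremum. -/
theorem commute_of_isLUB {B : Type*} [CStarAlgebra B] [PartialOrder B] [StarOrderedRing B]
    {X : Set B} {s u : B} (hs : IsLUB X s) (hu : u ∈ unitary B) (hX : ∀ x ∈ X, u * x = x * u) :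
    u * s = s * u := by
  have h1 := Unitary.star_mul_self_of_mem hu
  have h2 := Unitary.mul_star_self_of_mem hu
  have e1 : s ≤ u * s * star u := hs.2 fun x hx => by
    have := star_right_conjugate_le_conjugate (hs.1 hx) u
    rwa [hX x hx, mul_assoc, h2, mul_one] at this
  have e2 : s ≤ star u * s * u := hs.2 fun x hx => by
    have := star_left_conjugate_le_conjugate (hs.1 hx) u
    rwa [mul_assoc, ← hX x hx, ← mul_assoc, h1, one_mul] at this
  have e3 : u * s * star u ≤ s := by
    have := star_right_conjugate_le_conjugate e2 u
    have e : u * (star u * s * u) * star u = (u * star u) * s * (u * star u) := by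
      simp only [mul_assoc]
    rwa [e, h2, one_mul, mul_one] at this
  have e4 : s = u * s * star u := le_antisymm e1 e3
  calc u * s = u * s * (star u * u) := by rw [h1, mul_one]
    _ = u * s * star u * u := by simp only [mul_assoc]
    _ = s * u := by rw [← e4]

theorem isClosed_coe_centralizer {B : Type*} [CStarAlgebra B] (s : Set B) :
    IsClosed (StarSubalgebra.centralizer ℂ s : Set B) := by
  rw [StarSubalgebra.coe_centralizer]
  exact Set.isClosed_centralizer _

/-- The commutant of `T` is a C*-algebra, hence spanned by its unitaries, and `commute_of_isLUB`
handles each of these. -/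
theorem mem_centralizer_centralizer_of_isLUB {B : Type*} [CStarAlgebra B] [PartialOrder B]
    [StarOrderedRing B] {X T : Set B} {s : B} (hs : IsLUB X s)
    (hX : X ⊆ StarSubalgebra.centralizer ℂ (StarSubalgebra.centralizer ℂ T : Set B)) :
    s ∈ StarSubalgebra.centralizer ℂ (StarSubalgebra.centralizer ℂ T : Set B) := by
  have := isClosed_coe_centralizer T
  have key : ∀ c ∈ StarSubalgebra.centralizer ℂ T, c * s = s * c := fun c hc => by
    obtain ⟨u, a, hua, -⟩ := CStarAlgebra.exists_sum_four_unitary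
      (⟨c, hc⟩ : StarSubalgebra.centralizer ℂ T)
    have hc' : c = ∑ i, a i • ((u i : StarSubalgebra.centralizer ℂ T) : B) := by
      have := congrArg (fun x : StarSubalgebra.centralizer ℂ T => (x : B)) hua
      simpa using this
    have hu : ∀ i, ((u i : StarSubalgebra.centralizer ℂ T) : B) * s =
        s * ((u i : StarSubalgebra.centralizer ℂ T) : B) := fun i => by
      refine commute_of_isLUB hs ?_ fun x hx => ?_
      · exact Unitary.map_mem (StarSubalgebra.centralizer ℂ T).subtype (u i).2
      · exact (StarSubalgebra.mem_centralizer_iff ℂ |>.mp (hX hx) _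
          (u i : StarSubalgebra.centralizer ℂ T).2).1
    rw [hc', Finset.sum_mul, Finset.mul_sum]
    refine Finset.sum_congr rfl fun i _ => ?_
    rw [smul_mul_assoc, mul_smul_comm, hu]
  exact StarSubalgebra.mem_centralizer_iff ℂ |>.mpr fun c hc => ⟨key c hc, key _ (star_mem hc)⟩

/-- The spectrum of a bicommutant in an injective C*-algebra is extremally disconnected. -/
theorem extremallyDisconnected_of_range_eq {B : Type u} [CStarAlgebra B] (hB : IsInjective B)
    {Y : Type u} [TopologicalSpace Y] [CompactSpace Y] [T2Space Y] (j : C(Y, ℂ) →⋆ₐ[ℂ] B)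
    (hj : Function.Injective j) {T : Set B} (hT : range j =
      StarSubalgebra.centralizer ℂ (StarSubalgebra.centralizer ℂ T : Set B)) :
    ExtremallyDisconnected Y := by
  let _ := CStarAlgebra.spectralOrder B
  let _ := CStarAlgebra.spectralOrderedRing B
  refine ⟨fun U hU => ?_⟩
  -- The supremum in `B` of these functions lies in the bicommutant, so it is some `g` in `C(Y)`.
  -- Urysohn functions show `g = 1` on `U` and `g = 0` off `closure U`, so `closure U` is the open
  -- set where `g ≠ 0`.
  let I : Type u := {f : C(Y, ℝ) // (∀ y, 0 ≤ f y) ∧ (∀ y, f y ≤ 1) ∧ ∀ y, y ∉ U → f y = 0}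
  have : Nonempty I := ⟨⟨0, by simp⟩⟩
  have : IsDirectedOrder I := ⟨fun f g => ⟨⟨f.1 ⊔ g.1, fun y => le_sup_of_le_left (f.2.1 y),
    fun y => sup_le (f.2.2.1 y) (g.2.2.1 y), fun y hy => by simp [f.2.2.2 y hy, g.2.2.2 y hy]⟩,
    (le_sup_left : f.1 ≤ f.1 ⊔ g.1), (le_sup_right : g.1 ≤ f.1 ⊔ g.1)⟩⟩
  have hsub : ∀ f g : C(Y, ℝ), j (ofRealMap g) - j (ofRealMap f) = j (ofRealMap (g - f)) := by
    intro f g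
    rw [← map_sub]
    congr 1
    ext y
    simp [ofRealMap_apply]
  have hmono : ∀ f g : C(Y, ℝ), (∀ y, f y ≤ g y) → j (ofRealMap f) ≤ j (ofRealMap g) := by
    intro f g h
    rw [← sub_nonneg, hsub, ← isPos_iff_nonneg]
    exact IsPos.map j (isPos_ofRealMap.mpr fun y => sub_nonneg.mpr (h y))
  obtain ⟨s, hs⟩ := exists_isLUB_of_injective hB (x := fun f : I => j (ofRealMap f.1)) (R := 1)
    (fun f g h => hmono _ _ (show f.1 ≤ g.1 from h)) (fun f => by
      refine (NonUnitalStarAlgHom.norm_apply_le j _).trans ?_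
      rw [ContinuousMap.norm_le _ zero_le_one]
      intro y
      rw [ofRealMap_apply, Complex.norm_real, Real.norm_eq_abs, abs_of_nonneg (f.2.1 y)]
      exact f.2.2.1 y)
  obtain ⟨g, rfl⟩ : s ∈ range j := by
    rw [hT]
    refine mem_centralizer_centralizer_of_isLUB hs ?_
    rw [← hT]
    rintro _ ⟨f, rfl⟩
    exact ⟨_, rfl⟩
  have hlow : ∀ f : I, ∀ y, (f.1 y : ℂ) ≤ g y := fun f y => by
    have h := hs.1 ⟨f, rfl⟩
    rw [← sub_nonneg, ← map_sub, ← isPos_iff_nonneg] at h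
    have := isPos_continuousMap.mp (isPos_of_map j hj h) y
    simpa [ofRealMap_apply] using this
  have hupp : ∀ F : C(Y, ℝ), (∀ f : I, ∀ y, f.1 y ≤ F y) → ∀ y, g y ≤ (F y : ℂ) := fun F hF y => by
    have h := hs.2 (show j (ofRealMap F) ∈ _ by
      rintro _ ⟨f, rfl⟩
      exact hmono _ _ (hF f))
    rw [← sub_nonneg, ← map_sub, ← isPos_iff_nonneg] at h
    have := isPos_continuousMap.mp (isPos_of_map j hj h) y
    simpa [ofRealMap_apply] using this
  have hone : EqOn g 1 U := fun y hy => by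
    refine le_antisymm (by simpa using hupp 1 (fun f => f.2.2.1) y) ?_
    obtain ⟨w, hw0, hw1, hw⟩ := exists_continuous_zero_one_of_isClosed hU.isClosed_compl
      (isClosed_singleton (x := y)) (disjoint_singleton_right.mpr (by simpa using hy))
    have := hlow ⟨w, fun y => (hw y).1, fun y => (hw y).2, fun y hy => hw0 hy⟩ y
    rwa [show w y = 1 from hw1 rfl, Complex.ofReal_one] at this
  have hzero : ∀ y, y ∉ closure U → g y = 0 := fun y hy => by
    refine le_antisymm ?_ (by simpa using hlow ⟨0, by simp⟩ y)
    obtain ⟨w, hw0, hw1, hw⟩ := exists_continuous_zero_one_of_isClosed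
      (isClosed_singleton (x := y)) (isClosed_closure (s := U)) (disjoint_singleton_left.mpr hy)
    have := hupp w (fun f z => by
      by_cases hz : z ∈ U
      · rw [show w z = 1 from hw1 (subset_closure hz)]
        exact f.2.2.1 z
      · rw [f.2.2.2 z hz]
        exact (hw z).1) y
    rwa [show w y = 0 from hw0 rfl, Complex.ofReal_zero] at this
  have hcl : EqOn g 1 (closure U) := hone.closure g.continuous continuous_const
  have : closure U = g ⁻¹' {0}ᶜ := by
    ext y
    refine ⟨fun hy => ?_, fun hy => ?_⟩
    · have h1 : g y = 1 := hcl hy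
      simp [h1]
    · by_contra h
      exact hy (hzero y h)
  rw [this]
  exact isOpen_compl_singleton.preimage g.continuous

/-- The range of a homomorphism from a commutative C*-algebra to an injective one lies in a
commutative C*-algebra with extremally disconnected spectrum. -/
theorem exists_extremallyDisconnected_factorization {A B : Type u} [CommCStarAlgebra A]
    [CStarAlgebra B] (hB : IsInjective B) (π : A →⋆ₙₐ[ℂ] B) :
    ∃ (Y : Type u) (_ : TopologicalSpace Y) (_ : CompactSpace Y) (_ : T2Space Y)
      (j : C(Y, ℂ) →⋆ₐ[ℂ] B) (π' : A →⋆ₙₐ[ℂ] C(Y, ℂ)),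
      ExtremallyDisconnected Y ∧ Function.Injective j ∧ ∀ a, j (π' a) = π a := by
  let M := StarSubalgebra.centralizer ℂ (StarSubalgebra.centralizer ℂ (range π) : Set B)
  have hclosed : IsClosed (M : Set B) := isClosed_coe_centralizer _
  have hπM : ∀ a, π a ∈ M := fun a => by
    refine StarSubalgebra.mem_centralizer_iff ℂ |>.mpr fun c hc => ?_
    have h1 := StarSubalgebra.mem_centralizer_iff ℂ |>.mp hc _ ⟨a, rfl⟩
    have h2 := StarSubalgebra.mem_centralizer_iff ℂ |>.mp (star_mem hc) _ ⟨a, rfl⟩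
    exact ⟨h1.1.symm, h2.1.symm⟩
  -- `π(A)` is commutative and star-closed, so it lies in its own commutant; hence the bicommutant
  -- lies in the commutant, with which it commutes.
  have hcomm : ∀ x y : M, x * y = y * x := fun x y => by
    refine Subtype.ext ?_
    have hx : (x : B) ∈ StarSubalgebra.centralizer ℂ (range π) := by
      refine StarSubalgebra.mem_centralizer_iff ℂ |>.mpr ?_
      rintro _ ⟨a, rfl⟩
      have hab : ∀ b, π b ∈ StarSubalgebra.centralizer ℂ (range π) := fun b => by
        refine StarSubalgebra.mem_centralizer_iff ℂ |>.mpr ?_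
        rintro _ ⟨c, rfl⟩
        rw [← map_star, ← map_mul, ← map_mul, ← map_mul, ← map_mul, mul_comm c, mul_comm (star c)]
        exact ⟨rfl, rfl⟩
      exact StarSubalgebra.mem_centralizer_iff ℂ |>.mp x.2 _ (hab a)
    exact (StarSubalgebra.mem_centralizer_iff ℂ |>.mp y.2 _ hx).1
  let _ : CommCStarAlgebra M :=
    { (inferInstance : CStarAlgebra M) with mul_comm := hcomm }
  let Γ := gelfandStarTransform M
  let j : C(WeakDual.characterSpace ℂ M, ℂ) →⋆ₐ[ℂ] B :=
    M.subtype.comp (Γ.symm : _ →⋆ₐ[ℂ] M)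
  have hj : Function.Injective j := Subtype.val_injective.comp Γ.symm.injective
  have hjΓ : ∀ m, j (Γ m) = m := fun m => by
    change ((Γ.symm (Γ m) : M) : B) = m
    rw [StarAlgEquiv.symm_apply_apply]
  let π' : A →⋆ₙₐ[ℂ] C(WeakDual.characterSpace ℂ M, ℂ) :=
    { toFun := fun a => Γ ⟨π a, hπM a⟩
      map_smul' := fun c a => hj (by simp [hjΓ])
      map_zero' := hj (by simp [hjΓ])
      map_add' := fun a b => hj (by simp [hjΓ])
      map_mul' := fun a b => hj (by simp [hjΓ])
      map_star' := fun a => hj ((hjΓ _).trans (by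
        rw [map_star j, hjΓ]
        exact map_star π a)) }
  refine ⟨_, inferInstance, inferInstance, inferInstance, j, π', ?_, hj, fun a => hjΓ _⟩
  refine extremallyDisconnected_of_range_eq hB j hj (T := range π) ?_
  ext b
  refine ⟨?_, fun hb => ⟨Γ ⟨b, hb⟩, hjΓ _⟩⟩
  rintro ⟨f, rfl⟩
  exact (Γ.symm f).2

/-! ### Lifting a non-unital embedding to the Gleason cover -/

theorem extremallyDisconnected_of_isOpen {Y : Type*} [TopologicalSpace Y]
    [ExtremallyDisconnected Y] {W : Set Y} (hW : IsOpen W) : ExtremallyDisconnected W := by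
  refine ⟨fun U hU => ?_⟩
  rw [hW.isOpenEmbedding_subtypeVal.isInducing.closure_eq_preimage_closure_image]
  exact (ExtremallyDisconnected.open_closure _
    (hW.isOpenEmbedding_subtypeVal.isOpenMap _ hU)).preimage continuous_subtype_val

open Classical in
/-- Pull back a function along a map defined on a clopen set, and extend it by zero. -/
noncomputable def pullbackExtend {Y G : Type*} [TopologicalSpace Y] [TopologicalSpace G] {W : Set Y}
    (hW : IsClopen W) (l : C(W, G)) : C(G, ℂ) →⋆ₙₐ[ℂ] C(Y, ℂ) where
  toFun f := ⟨fun y => if h : y ∈ W then f (l ⟨y, h⟩) else 0, by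
    refine continuous_iff_continuousAt.mpr fun y => ?_
    by_cases hy : y ∈ W
    · refine (hW.isOpen.isOpenEmbedding_subtypeVal.continuousAt_iff (x := ⟨y, hy⟩)).mp ?_
      have : (fun y => if h : y ∈ W then f (l ⟨y, h⟩) else 0) ∘ (Subtype.val : W → Y) = f ∘ l := by
        funext z
        simp
      rw [this]
      exact (f.continuous.comp l.continuous).continuousAt
    · refine (continuousAt_const (y := (0 : ℂ))).congr ?_
      filter_upwards [hW.isClosed.isOpen_compl.mem_nhds hy] with z hz
      have hz' : z ∉ W := hz
      simp [hz']⟩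
  map_smul' c f := by ext y; by_cases h : y ∈ W <;> simp [h]
  map_zero' := by ext y; by_cases h : y ∈ W <;> simp
  map_add' f g := by ext y; by_cases h : y ∈ W <;> simp [h]
  map_mul' f g := by ext y; by_cases h : y ∈ W <;> simp [h]
  map_star' f := by ext y; by_cases h : y ∈ W <;> simp [h]

theorem pullbackExtend_apply {Y G : Type*} [TopologicalSpace Y] [TopologicalSpace G] {W : Set Y}
    (hW : IsClopen W) (l : C(W, G)) (f : C(G, ℂ)) (y : W) :
    pullbackExtend hW l f y = f (l y) := by
  simp [pullbackExtend]

theorem pullbackExtend_apply_of_notMem {Y G : Type*} [TopologicalSpace Y] [TopologicalSpace G]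
    {W : Set Y} (hW : IsClopen W) (l : C(W, G)) (f : C(G, ℂ)) {y : Y} (hy : y ∉ W) :
    pullbackExtend hW l f y = 0 := by
  simp [pullbackExtend, hy]

section Support

variable {A Y : Type*} [CommCStarAlgebra A] [TopologicalSpace Y]

/-- The set where the image of the unit is nonzero. -/
def unitSupport (π : A →⋆ₙₐ[ℂ] C(Y, ℂ)) : Set Y := {y | π 1 y = 1}

/-- `π 1 y` is an idempotent complex number, so it is 0 or 1; this also makes the support clopen. -/
theorem map_eq_zero_of_notMem_unitSupport (π : A →⋆ₙₐ[ℂ] C(Y, ℂ)) {y : Y} (hy : y ∉ unitSupport π)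
    (a : A) : π a y = 0 := by
  have h1 : π 1 y * π 1 y = π 1 y := by
    rw [← ContinuousMap.mul_apply, ← map_mul, mul_one]
  have h2 : π 1 y = 0 := by
    by_contra h
    exact hy (mul_left_cancel₀ h (by rw [h1, mul_one]))
  rw [← mul_one a, map_mul, ContinuousMap.mul_apply, h2, mul_zero]

theorem isClopen_unitSupport (π : A →⋆ₙₐ[ℂ] C(Y, ℂ)) : IsClopen (unitSupport π) := by
  refine ⟨isClosed_eq (π 1).continuous continuous_const, ?_⟩
  have : unitSupport π = (π 1) ⁻¹' {0}ᶜ := by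
    ext y
    refine ⟨fun hy => ?_, fun hy => ?_⟩
    · have h : π 1 y = 1 := hy
      simp [h]
    · by_contra h
      exact hy (map_eq_zero_of_notMem_unitSupport π h 1)
  rw [this]
  exact isOpen_compl_singleton.preimage (π 1).continuous

/-- The map on spectra dual to a homomorphism that need not be unital. -/
noncomputable def dualMap (π : A →⋆ₙₐ[ℂ] C(Y, ℂ)) :
    C(unitSupport π, WeakDual.characterSpace ℂ A) where
  toFun y := WeakDual.CharacterSpace.equivAlgHom.symm (AlgHom.ofLinearMap
    { toFun := fun a => π a y
      map_add' := fun a b => by simp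
      map_smul' := fun c a => by simp } y.2 fun a b => by simp)
  continuous_toFun := by
    refine Continuous.subtype_mk (WeakDual.continuous_of_continuous_eval fun a => ?_) _
    exact (π a).continuous.comp continuous_subtype_val

theorem dualMap_apply (π : A →⋆ₙₐ[ℂ] C(Y, ℂ)) (y : unitSupport π) (a : A) :
    dualMap π y a = π a y := rfl

/-- A Urysohn function vanishing on the compact image and equal to 1 at a missed character would
come from a nonzero element of `A` killed by `π`. -/
theorem dualMap_surjective [CompactSpace Y] {π : A →⋆ₙₐ[ℂ] C(Y, ℂ)} (hπ : Function.Injective π) :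
    Function.Surjective (dualMap π) := by
  intro x
  by_contra hx
  have : CompactSpace (unitSupport π) :=
    isCompact_iff_compactSpace.mp (isClopen_unitSupport π).isClosed.isCompact
  obtain ⟨w, hw0, hw1, -⟩ := exists_continuous_zero_one_of_isClosed
    (isCompact_range (dualMap π).continuous).isClosed (isClosed_singleton (x := x))
    (disjoint_singleton_right.mpr hx)
  obtain ⟨a, ha⟩ := (gelfandStarTransform A).surjective (ofRealMap w)
  have haw : ∀ z : WeakDual.characterSpace ℂ A, z a = w z := fun z =>
    congrArg (fun f : C(WeakDual.characterSpace ℂ A, ℂ) => f z) ha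
  have ha0 : a = 0 := hπ (by
    rw [map_zero]
    ext y
    by_cases hy : y ∈ unitSupport π
    · rw [← dualMap_apply π ⟨y, hy⟩, haw, show w (dualMap π ⟨y, hy⟩) = 0 from hw0 ⟨_, rfl⟩]
      simp
    · simpa using map_eq_zero_of_notMem_unitSupport π hy a)
  have h1 := haw x
  rw [ha0, map_zero, show w x = 1 from hw1 rfl] at h1
  simp at h1

end Support

/-- An embedding in the functions on an extremally disconnected space extends along a Gleason
cover. -/
theorem exists_extension_coverHom {A Y G : Type u} [CommCStarAlgebra A] [TopologicalSpace Y]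
    [CompactSpace Y] [T2Space Y] [ExtremallyDisconnected Y] [TopologicalSpace G] [CompactSpace G]
    [T2Space G] (p : C(G, WeakDual.characterSpace ℂ A)) (hs : Function.Surjective p)
    (hp : IsIrreducibleMap p) (π : A →⋆ₙₐ[ℂ] C(Y, ℂ)) (hπ : Function.Injective π) :
    ∃ σ : C(G, ℂ) →⋆ₙₐ[ℂ] C(Y, ℂ), Function.Injective σ ∧ ∀ a, σ (coverHom p a) = π a := by
  have hW := isClopen_unitSupport π
  have : CompactSpace (unitSupport π) := isCompact_iff_compactSpace.mp hW.isClosed.isCompact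
  have := extremallyDisconnected_of_isOpen hW.isOpen
  obtain ⟨l, hl, hlp⟩ := CompactT2.ExtremallyDisconnected.projective
    (dualMap π).continuous p.continuous hs
  -- The image of `l` is closed and `p` maps it onto the whole character space, so irreducibility
  -- leaves no room for it to be proper.
  have hls : Function.Surjective l := by
    rw [← range_eq_univ]
    by_contra h
    refine hp _ h (isCompact_range hl).isClosed ?_
    rw [← range_comp, hlp]
    exact (dualMap_surjective hπ).range_eq
  refine ⟨pullbackExtend hW ⟨l, hl⟩, fun f g hfg => ?_, fun a => ?_⟩
  · ext z
    obtain ⟨y, rfl⟩ := hls z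
    have := congrArg (fun h : C(Y, ℂ) => h y) hfg
    simp only [pullbackExtend_apply] at this
    exact this
  · ext y
    by_cases hy : y ∈ unitSupport π
    · have h1 := pullbackExtend_apply hW ⟨l, hl⟩ (coverHom p a) ⟨y, hy⟩
      refine h1.trans ?_
      have h2 : p (l ⟨y, hy⟩) = dualMap π ⟨y, hy⟩ := congrFun hlp ⟨y, hy⟩
      change p (l ⟨y, hy⟩) a = _
      rw [h2, dualMap_apply]
    · rw [pullbackExtend_apply_of_notMem hW _ _ hy, map_eq_zero_of_notMem_unitSupport π hy]

end OpSys

theorem theorem2p21 (A : Type u) [CommCStarAlgebra A] :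
    (∃ (E : Type u) (_ : CStarAlgebra E) (κ : A →⋆ₐ[ℂ] E), OpSys.IsInjectiveEnvelope κ) ∧
    ∀ (E : Type u) [CStarAlgebra E] (κ : A →⋆ₐ[ℂ] E), OpSys.IsInjectiveEnvelope κ →
      ∀ (B : Type u) [CStarAlgebra B], OpSys.IsInjective B →
        ∀ π : A →⋆ₙₐ[ℂ] B, Function.Injective π →
          ∃ ρ : E →⋆ₙₐ[ℂ] B, Function.Injective ρ ∧ ∀ a : A, ρ (κ a) = π a := by
  obtain ⟨G, _, _, _, p, hG, hc, hs, hp⟩ :=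
    OpSys.exists_gleason_cover (WeakDual.characterSpace ℂ A)
  have henv := OpSys.isInjectiveEnvelope_coverHom ⟨p, hc⟩ hG hs hp
  refine ⟨⟨C(G, ℂ), inferInstance, _, henv⟩, fun E _ κ hκ B _ hB π hπ => ?_⟩
  obtain ⟨θ, hθ, hθκ⟩ := hκ.exists_starAlgHom henv
  obtain ⟨Y, _, _, _, j, π', hY, hj, hjπ⟩ :=
    OpSys.exists_extremallyDisconnected_factorization hB π
  have hπ' : Function.Injective π' := fun a b hab => hπ (by rw [← hjπ, ← hjπ, hab])
  obtain ⟨σ, hσ, hσp⟩ := OpSys.exists_extension_coverHom ⟨p, hc⟩ hs hp π' hπ'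
  refine ⟨(j.toNonUnitalStarAlgHom.comp σ).comp θ.toNonUnitalStarAlgHom,
    hj.comp (hσ.comp hθ), fun a => ?_⟩
  change j (σ (θ (κ a))) = π a
  rw [hθκ, hσp, hjπ]
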